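/- Let $k_0\ge k_1\ge 0$ be integers and let $M$ be the space of complex $(k_0+1)\times(k_1+1)$ matrices. For an integer $r\ge 0$ let $D_r\subset\mathbb P(M)$ be the set of classes of nonzero matrices of rank at most $r$ (so $D_0=\emptyset$ and $D_{k_1+1}=\mathbb P(M)$). For an irreducible projective variety $X\subset\mathbb P(V)$, where $V$ is a finite-dimensional complex vector space, the dual variety $X^\vee\subset\mathbb P(V^\vee)$ is the Zariski closure of the set of hyperplanes that contain the projective tangent space of $X$ at some nonsingular point of $X$. Identify $\mathbb P(M^\vee)$ with $\mathbb P(M)$ by letting the class of a matrix $A=(a_{ij})$ correspond to the hyperplane $\{[B]\in\mathbb P(M) : \sum_{i,j}a_{ij}b_{ij}=0\}$. Then for every $r$ with $1\le r\le k_1+1$, $$D_r^\vee = D_{k_1+1-r}.$$ In the square case $k_0=k_1$, the determinant hypersurface $\{[A] : \det A=0\}$ is the dual variety $D_1^\vee$ of the Segre variety $D_1$. -/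

import Mathlib

open scoped LinearAlgebra.Projectivization

namespace ProjDual

noncomputable section

section General

variable {K V ι : Type*} [Field K] [AddCommGroup V] [Module K V]

/-- The Zariski closure of a set `S` of points of the projective space `ℙ K V`: all points at which
every homogeneous polynomial vanishing on `S` vanishes. Polynomials are written in the linear
coordinates given by a basis `b` of `V` (the result does not depend on `b`, and the vanishing of a
homogeneous polynomial does not depend on the chosen representative vectors). -/
def zariskiClosure (b : Module.Basis ι K V) (S : Set (ℙ K V)) : Set (ℙ K V) :=
  {p | ∀ (f : MvPolynomial ι K) (n : ℕ), f.IsHomogeneous n →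
    (∀ q ∈ S, MvPolynomial.eval (fun i => b.repr q.rep i) f = 0) →
      MvPolynomial.eval (fun i => b.repr p.rep i) f = 0}

/-- The affine cone in `V` over a set `X` of points of `ℙ K V` (with the vertex `0`). -/
def affineCone (X : Set (ℙ K V)) : Set V :=
  {v | ∀ h : v ≠ 0, Projectivization.mk K v h ∈ X}

/-- The ideal of all polynomials, in the coordinates given by `b`, that vanish on the affine cone
over `X`. -/
def coneIdeal (b : Module.Basis ι K V) (X : Set (ℙ K V)) : Ideal (MvPolynomial ι K) :=
  MvPolynomial.vanishingIdeal K ((fun v : V => fun i => b.repr v i) '' affineCone X)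

/-- The Zariski tangent space at `v` of the affine cone over `X`, as a linear subspace of `V`: the
common kernel of the differentials at `v` of all the polynomials vanishing on the cone. Its
projectivization is the projective tangent space of `X` at the point `[v]`. -/
def tangentSpace [Fintype ι] (b : Module.Basis ι K V) (X : Set (ℙ K V)) (v : V) :
    Submodule K V where
  carrier := {w | ∀ f ∈ coneIdeal b X,
    ∑ i, MvPolynomial.eval (fun j => b.repr v j) (MvPolynomial.pderiv i f) * b.repr w i = 0}
  zero_mem' := by
    intro f _
    simp
  add_mem' := by
    intro w₁ w₂ h₁ h₂ f hf
    have e₁ := h₁ f hf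
    have e₂ := h₂ f hf
    simp only [map_add, Finsupp.add_apply, mul_add, Finset.sum_add_distrib, e₁, e₂, add_zero]
  smul_mem' := by
    intro c w h f hf
    have e := h f hf
    simp only [map_smul, Finsupp.smul_apply, smul_eq_mul, mul_left_comm _ c, ← Finset.mul_sum, e,
      mul_zero]

/-- The point `p` of the irreducible projective variety `X` is nonsingular: the dimension of the
(affine) tangent space is the dimension of the affine cone over `X`, that is, the Krull dimension of
the homogeneous coordinate ring of `X`. (Equivalently, in projective terms, the tangent space at `p`
has dimension `dim X`.) -/
def IsNonsingularAt [Fintype ι] (b : Module.Basis ι K V) (X : Set (ℙ K V)) (p : ℙ K V) : Prop :=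
  (Module.finrank K (tangentSpace b X p.rep) : WithBot ℕ∞) =
    ringKrullDim (MvPolynomial ι K ⧸ coneIdeal b X)

/-- The set of tangent hyperplanes of `X`, as points of the projective space of the dual space: the
hyperplanes `H` that contain the tangent space of `X` at some nonsingular point of `X`. A point `H`
of `ℙ K (Module.Dual K V)` is the class of a nonzero linear form, and the hyperplane is its
kernel. -/
def tangentHyperplanes [Fintype ι] (b : Module.Basis ι K V) (X : Set (ℙ K V)) :
    Set (ℙ K (Module.Dual K V)) :=
  {H | ∃ p ∈ X, IsNonsingularAt b X p ∧ tangentSpace b X p.rep ≤ LinearMap.ker H.rep}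

/-- The dual variety of the irreducible projective variety `X`: the Zariski closure, in the
projective space of the dual space, of the set of tangent hyperplanes of `X`. -/
def dualVariety [Fintype ι] [DecidableEq ι] (b : Module.Basis ι K V) (X : Set (ℙ K V)) :
    Set (ℙ K (Module.Dual K V)) :=
  zariskiClosure b.dualBasis (tangentHyperplanes b X)

end General

section Matrices

variable (K : Type*) [Field K] (m n : ℕ)

/-- The locus `D_r` of classes of `m × n` matrices of rank at most `r`, in the projective space of
`m × n` matrices. -/
def rankLocus (r : ℕ) : Set (ℙ K (Matrix (Fin m) (Fin n) K)) :=
  {p | p.rep.rank ≤ r}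

/-- The hypersurface `det = 0` in the projective space of `n × n` matrices. -/
def detHypersurface : Set (ℙ K (Matrix (Fin n) (Fin n) K)) :=
  {p | p.rep.det = 0}

/-- The identification of the space of matrices with its dual given by the dual bases: the matrix
`A` is sent to the linear form `B ↦ ∑ i, ∑ j, A i j * B i j = trace (Aᵀ * B)`. -/
def matrixPairing :
    Matrix (Fin m) (Fin n) K →ₗ[K] Module.Dual K (Matrix (Fin m) (Fin n) K) :=
  LinearMap.mk₂ K (fun A B => ∑ i, ∑ j, A i j * B i j)
    (by intro A A' B; simp [add_mul, Finset.sum_add_distrib])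
    (by intro c A B; simp [Finset.mul_sum, mul_assoc])
    (by intro A B B'; simp [mul_add, Finset.sum_add_distrib])
    (by intro c A B; simp [Finset.mul_sum, mul_left_comm])

theorem matrixPairing_apply (A B : Matrix (Fin m) (Fin n) K) :
    matrixPairing K m n A B = ∑ i, ∑ j, A i j * B i j := rfl

theorem matrixPairing_injective : Function.Injective (matrixPairing K m n) := by
  intro A A' h
  ext i j
  have := congrArg (fun φ => φ (Matrix.single i j (1 : K))) h
  simpa [matrixPairing_apply, Matrix.single_apply, ite_and] using this

/-- The induced map from the projective space of matrices to the projective space of its dual: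
the point `[A]` goes to the hyperplane `{[B] | ∑ i, ∑ j, A i j * B i j = 0}`. -/
def toDualSpace :
    ℙ K (Matrix (Fin m) (Fin n) K) → ℙ K (Module.Dual K (Matrix (Fin m) (Fin n) K)) :=
  Projectivization.map (matrixPairing K m n) (matrixPairing_injective K m n)

end Matrices

end

end ProjDual

/-! Write `m = k₀ + 1`, `n = k₁ + 1`. The tangent hyperplanes of `D_r` are exactly the points of
`D_{n-r}`, which is already closed, being cut out by minors.

The tangent space of the cone at a matrix of rank `r` is known once the matrix is written `P *
partialOne * Q` with `P`, `Q` invertible: it consists of the `P * W * Q` with `W` zero outside the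
first `r` rows and columns. Lines inside the cone give one inclusion (`mul_mul_mem_tangentSpace`),
derivatives of minors of size `r + 1` the other (`eq_zero_of_mem_tangentSpace`), so generators of
the ideal are never needed. A form `C` that vanishes on the tangent space satisfies `C * Aᵀ = 0`,
hence has rank at most `n - r`. Conversely, if `C` has such a rank, `P` and `Q` can be chosen from
the kernels of `Cᵀ` and `C`.

Nonsingularity at these points compares the dimension of the tangent space with the Krull dimension
of the coordinate ring. The ring is a domain, and the entries in the first `r` rows and columns form
a transcendence basis of it (`isTranscendenceBasis_rankLocus`), which gives the same count. -/

open scoped LinearAlgebra.Projectivization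

/-! ### Krull dimension and transcendence bases. -/

/-- An injective integral ring homomorphism preserves the Krull dimension. -/
theorem ringKrullDim_eq_of_injective_of_isIntegral {R S : Type*} [CommRing R] [CommRing S]
    (f : R →+* S) (hf : Function.Injective f) (hi : f.IsIntegral) :
    ringKrullDim S = ringKrullDim R := by
  algebraize [f]
  apply le_antisymm
  · exact Order.krullDim_le_of_strictMono (PrimeSpectrum.comap (algebraMap R S))
      fun I J h => Ideal.IsIntegral.comap_lt_comap (R := R) h
  · refine iSup_le fun l => ?_
    obtain ⟨Q, hQl⟩ := hi.comap_surjective hf (RelSeries.head l)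
    have : Q.asIdeal.LiesOver (RelSeries.head l).asIdeal :=
      ⟨congrArg PrimeSpectrum.asIdeal hQl.symm⟩
    obtain ⟨M, hM, -⟩ := Ideal.exists_ltSeries_of_hasGoingUp (S := S) l Q.asIdeal
    rw [← hM]
    exact le_iSup (fun p : LTSeries (PrimeSpectrum S) => (p.length : WithBot ℕ∞)) M

/-- The Krull dimension of a finitely generated domain over a field is the cardinality of any of
its transcendence bases. -/
theorem ringKrullDim_eq_card_of_isTranscendenceBasis {k A ι : Type*} [Field k] [CommRing A]
    [IsDomain A] [Algebra k A] [Algebra.FiniteType k A] [Fintype ι] {x : ι → A}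
    (hx : IsTranscendenceBasis k x) : ringKrullDim A = Fintype.card ι := by
  -- Noether normalization: the `s` variables form a second transcendence basis of `A`, and any two
  -- have the same cardinality.
  obtain ⟨s, g, hg, hgi⟩ := exists_integral_inj_algHom_of_fg k A
  rw [ringKrullDim_eq_of_injective_of_isIntegral g.toRingHom hg hgi,
    MvPolynomial.ringKrullDim_of_isNoetherianRing, ringKrullDim_eq_zero_of_field, zero_add,
    Nat.card_fin]
  algebraize [g.toRingHom]
  have : FaithfulSMul (MvPolynomial (Fin s) k) A :=
    (faithfulSMul_iff_algebraMap_injective _ _).mpr hg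
  have : IsScalarTower k (MvPolynomial (Fin s) k) A :=
    IsScalarTower.of_algebraMap_eq fun c => (g.commutes c).symm
  have hy := (IsTranscendenceBasis.mvPolynomial (Fin s) k).algebraMap_comp (A := A)
  have := hx.lift_cardinalMk_eq hy
  simp only [Cardinal.mk_fintype, Cardinal.lift_natCast, Nat.cast_inj, Fintype.card_fin] at this
  rw [this]

/-! ### Polynomials restricted to a line. -/

theorem MvPolynomial.eval_aeval_line {ι K : Type*} [CommRing K] (a w : ι → K)
    (f : MvPolynomial ι K) (t : K) :
    (aeval (fun i => Polynomial.C (a i) + Polynomial.X * Polynomial.C (w i)) f).eval t =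
      eval (fun i => a i + t * w i) f := by
  rw [← Polynomial.coe_aeval_eq_eval, ← AlgHom.comp_apply, ← aeval_eq_eval]
  exact congrArg (fun φ : MvPolynomial ι K →ₐ[K] K => φ f) (by ext i; simp; ring)

/-- The derivative at `0` of a polynomial restricted to the line through `a` in the direction
`w`. -/
theorem MvPolynomial.eval_derivative_line {ι K : Type*} [Fintype ι] [CommRing K] (a w : ι → K)
    (f : MvPolynomial ι K) :
    (Polynomial.derivative
      (aeval (fun i => Polynomial.C (a i) + Polynomial.X * Polynomial.C (w i)) f)).eval 0 =
      ∑ i, eval a (pderiv i f) * w i := by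
  classical
  induction f using MvPolynomial.induction_on with
  | C c => simp
  | add p q hp hq =>
    simp only [map_add, Polynomial.eval_add, hp, hq, add_mul, Finset.sum_add_distrib]
  | mul_X p j hp =>
    simp only [map_mul, Polynomial.derivative_mul, Polynomial.eval_add, Polynomial.eval_mul, hp,
      eval_aeval_line, aeval_X, pderiv_mul, eval_X, pderiv_X, map_add, add_mul, Finset.sum_add_distrib,
      Finset.sum_mul]
    congr 1
    · exact Finset.sum_congr rfl fun i _ => by simp; ring
    · rw [Finset.sum_eq_single j (by intro i _ h; simp [h.symm]) (by simp)]
      simp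

theorem Matrix.stdBasis_repr_apply {K m n : Type*} [Field K] [Fintype m] [Fintype n]
    (A : Matrix m n K) (p : m × n) : (Matrix.stdBasis K m n).repr A p = A p.1 p.2 := by
  simp [Matrix.stdBasis]

/-! ### The cone over the rank locus and its ideal. -/

namespace ProjDual

variable {K : Type*} [Field K] {m n r : ℕ}

theorem mk_mem_rankLocus {A : Matrix (Fin m) (Fin n) K} (h : A ≠ 0) :
    Projectivization.mk K A h ∈ rankLocus K m n r ↔ A.rank ≤ r := by
  obtain ⟨a, ha⟩ := Projectivization.exists_smul_eq_mk_rep K A h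
  have e : ((a : K) • A).rank = A.rank :=
    Matrix.rank_smul_of_mem_nonZeroDivisors _ a.isUnit.mem_nonZeroDivisors
  change (Projectivization.mk K A h).rep.rank ≤ r ↔ _
  rw [← ha, Units.smul_def, e]

theorem mem_affineCone_rankLocus {A : Matrix (Fin m) (Fin n) K} :
    A ∈ affineCone (rankLocus K m n r) ↔ A.rank ≤ r := by
  refine ⟨fun h => ?_, fun h h0 => (mk_mem_rankLocus h0).mpr h⟩
  by_cases h0 : A = 0
  · simp [h0]
  · exact (mk_mem_rankLocus h0).mp (h h0)

theorem mem_coneIdeal_rankLocus {f : MvPolynomial (Fin m × Fin n) K} :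
    f ∈ coneIdeal (Matrix.stdBasis K (Fin m) (Fin n)) (rankLocus K m n r) ↔
      ∀ A : Matrix (Fin m) (Fin n) K, A.rank ≤ r →
        MvPolynomial.eval (fun p => A p.1 p.2) f = 0 := by
  simp only [coneIdeal, MvPolynomial.mem_vanishingIdeal_iff, Set.forall_mem_image,
    mem_affineCone_rankLocus, Matrix.stdBasis_repr_apply]
  rfl

theorem mem_tangentSpace_rankLocus {A W : Matrix (Fin m) (Fin n) K} :
    W ∈ tangentSpace (Matrix.stdBasis K (Fin m) (Fin n)) (rankLocus K m n r) A ↔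
      ∀ f ∈ coneIdeal (Matrix.stdBasis K (Fin m) (Fin n)) (rankLocus K m n r),
        ∑ p, MvPolynomial.eval (fun q => A q.1 q.2) (MvPolynomial.pderiv p f) * W p.1 p.2 = 0 := by
  change (∀ f ∈ _, _) ↔ _
  simp only [Matrix.stdBasis_repr_apply]

/-- A direction of a line through `A` that is contained in the cone is tangent at `A`. -/
theorem mem_tangentSpace_of_line [Infinite K] {A W : Matrix (Fin m) (Fin n) K}
    (h : ∀ t : K, (A + t • W).rank ≤ r) :
    W ∈ tangentSpace (Matrix.stdBasis K (Fin m) (Fin n)) (rankLocus K m n r) A := by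
  rw [mem_tangentSpace_rankLocus]
  intro f hf
  rw [← MvPolynomial.eval_derivative_line]
  -- The restriction of `f` to the line vanishes at every `t`, hence identically, as `K` is
  -- infinite.
  have e : MvPolynomial.aeval (fun i : Fin m × Fin n => Polynomial.C (A i.1 i.2) +
      Polynomial.X * Polynomial.C (W i.1 i.2)) f = 0 := by
    refine Polynomial.funext fun t => ?_
    rw [MvPolynomial.eval_aeval_line, Polynomial.eval_zero]
    simpa only [Matrix.add_apply, Matrix.smul_apply, smul_eq_mul] using
      mem_coneIdeal_rankLocus.mp hf (A + t • W) (h t)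
  rw [e, Polynomial.derivative_zero, Polynomial.eval_zero]

end ProjDual

/-! ### Linear algebra: adapted bases, rank and bordered determinants. -/

theorem Matrix.rank_add_le {K m n : Type*} [Field K] [Fintype m] [Fintype n] (A B : Matrix m n K) :
    (A + B).rank ≤ A.rank + B.rank := by
  rw [Matrix.rank, Matrix.mulVecLin_add]
  refine (Submodule.finrank_mono (LinearMap.range_add_le _ _)).trans ?_
  exact Submodule.finrank_add_le_finrank_add_finrank _ _

/-- A subspace of dimension at least `r` contains the first `r` columns of an invertible matrix. -/
theorem exists_isUnit_det_col_mem {K : Type*} [Field K] {m r : ℕ} (S : Submodule K (Fin m → K))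
    (h : r ≤ Module.finrank K S) :
    ∃ P : Matrix (Fin m) (Fin m) K, IsUnit P.det ∧ ∀ j : Fin m, (j : ℕ) < r → P.col j ∈ S := by
  obtain ⟨v, hv⟩ := exists_linearIndependent_of_le_finrank h
  have hv' : LinearIndependent K (fun i => (v i : Fin m → K)) :=
    hv.map' S.subtype (Submodule.ker_subtype S)
  let b := Module.Basis.sumExtend hv'
  have hfin := Module.Finite.finite_basis b
  have : Finite (Module.Basis.sumExtendIndex hv') := Finite.sum_right (Fin r)
  have : Fintype (Module.Basis.sumExtendIndex hv') := Fintype.ofFinite _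
  have hc : r + Fintype.card (Module.Basis.sumExtendIndex hv') = m := by
    have := Module.finrank_eq_card_basis b
    simpa using this.symm
  let e : Fin r ⊕ Module.Basis.sumExtendIndex hv' ≃ Fin m :=
    (((Equiv.refl _).sumCongr (Fintype.equivFin _)).trans finSumFinEquiv).trans (finCongr hc)
  let c := b.reindex e
  refine ⟨Matrix.of fun i j => c j i, ?_, fun j hj => ?_⟩
  · rw [← Matrix.isUnit_iff_isUnit_det, ← Matrix.linearIndependent_cols_iff_isUnit]
    exact c.linearIndependent
  · obtain ⟨k, rfl⟩ : ∃ k, j = e (Sum.inl k) := ⟨⟨j, hj⟩, by ext; simp [e]⟩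
    have hcol : (Matrix.of fun i j => c j i).col (e (Sum.inl k)) = v k := by
      have : b (Sum.inl k) = v k := by
        simp [b, Module.Basis.sumExtend]
        rfl
      ext i
      simp [Matrix.col_apply, c, this]
    rw [hcol]
    exact (v _).2

/-- A matrix of rank at least `s` is carried to the identity matrix of size `s` by multiplication on
both sides. -/
theorem Matrix.exists_mul_mul_eq_one {K m n : Type*} [Field K] [Fintype m] [Fintype n] {s : ℕ}
    (A : Matrix m n K) (h : s ≤ A.rank) :
    ∃ (P : Matrix (Fin s) m K) (Q : Matrix n (Fin s) K), P * A * Q = 1 := by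
  obtain ⟨v, hv⟩ := exists_linearIndependent_of_le_finrank h
  have hv' : LinearIndependent K (fun i => (v i : m → K)) :=
    hv.map' (LinearMap.range A.mulVecLin).subtype (Submodule.ker_subtype _)
  choose q hq using fun i => (v i).2
  let Q : Matrix n (Fin s) K := Matrix.of fun j i => q i j
  have hcol : LinearIndependent K (A * Q).col := by
    convert hv' using 2 with i
    rw [← hq i]
    rfl
  -- The columns of `A * Q` are independent vectors of the range of `A`, so `A * Q` has a left
  -- inverse, which serves as `P`.
  have hinj : LinearMap.ker (A * Q).mulVecLin = ⊥ :=
    LinearMap.ker_eq_bot.mpr (Matrix.mulVec_injective_iff.mpr hcol)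
  obtain ⟨g, hg⟩ := LinearMap.exists_leftInverse_of_injective _ hinj
  classical
  refine ⟨LinearMap.toMatrix' g, Q, ?_⟩
  rw [Matrix.mul_assoc, ← LinearMap.toMatrix'_id, ← hg, LinearMap.toMatrix'_comp,
    ← Matrix.toLin'_apply', LinearMap.toMatrix'_toLin']

/-- The derivative at `0` of a bordered minor of a partial identity matrix along a line. -/
theorem Polynomial.eval_derivative_det_fromBlocks {K m : Type*} [Field K] [Fintype m] [DecidableEq m]
    (A : Matrix m m K) (B : Matrix m Unit K) (C : Matrix Unit m K) (D : Matrix Unit Unit K) :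
    (derivative (Matrix.fromBlocks (1 + (X : Polynomial K) • A.map Polynomial.C)
      ((X : Polynomial K) • B.map Polynomial.C) ((X : Polynomial K) • C.map Polynomial.C)
      ((X : Polynomial K) • D.map Polynomial.C)).det).eval 0 = D () () := by
  -- Pulling the factor `X` out of the last row leaves `N`; the derivative at `0` is then `det N` at
  -- `0`, where `N` is block lower triangular.
  set N := Matrix.fromBlocks (1 + (X : Polynomial K) • A.map Polynomial.C)
      ((X : Polynomial K) • B.map Polynomial.C) (C.map Polynomial.C) (D.map Polynomial.C) with hN
  have h : Matrix.fromBlocks (1 + (X : Polynomial K) • A.map Polynomial.C)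
      ((X : Polynomial K) • B.map Polynomial.C) ((X : Polynomial K) • C.map Polynomial.C)
      ((X : Polynomial K) • D.map Polynomial.C) =
      Matrix.fromBlocks 1 0 0 ((X : Polynomial K) • (1 : Matrix Unit Unit (Polynomial K))) * N := by
    simp [hN, Matrix.fromBlocks_multiply]
  have h0 : N.det.eval 0 = D () () := by
    rw [← Polynomial.coe_evalRingHom, RingHom.map_det]
    have : (Polynomial.evalRingHom (0 : K)).mapMatrix N = Matrix.fromBlocks 1 0 C D := by
      ext (i | i) (j | j) <;> simp [hN, Matrix.one_apply, apply_ite]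
    rw [this, Matrix.det_fromBlocks_zero₁₂]
    simp
  rw [h, Matrix.det_mul, Matrix.det_fromBlocks_zero₁₂]
  simp [h0]

/-! ### Upper bound for the tangent hyperplanes. -/

namespace ProjDual

variable {K : Type*} [Field K] {m n r : ℕ}

/-- Adding a matrix of rank one keeps the rank at most `r`, and matrices with a single nonzero entry
span. Hence points of rank below `r` lie on no tangent hyperplane. -/
theorem tangentSpace_rankLocus_eq_top [Infinite K] {A : Matrix (Fin m) (Fin n) K} (h : A.rank < r) :
    tangentSpace (Matrix.stdBasis K (Fin m) (Fin n)) (rankLocus K m n r) A = ⊤ := by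
  refine eq_top_iff.mpr fun W _ => ?_
  rw [Matrix.matrix_eq_sum_single W]
  refine sum_mem fun i _ => sum_mem fun j _ => mem_tangentSpace_of_line fun t => ?_
  have e : t • Matrix.single i j (W i j) =
      Matrix.vecMulVec (Pi.single i (t * W i j)) (Pi.single j 1) := by
    ext k l
    by_cases hk : i = k <;> by_cases hl : j = l <;>
      simp [Matrix.vecMulVec_apply, hk, hl, Ne.symm]
  rw [e]
  have := Matrix.rank_add_le A (Matrix.vecMulVec (Pi.single i (t * W i j)) (Pi.single j 1))
  have := Matrix.rank_vecMulVec_le (Pi.single i (t * W i j)) (Pi.single j (1 : K))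
  omega

theorem mul_mem_tangentSpace [Infinite K] {A : Matrix (Fin m) (Fin n) K} (h : A.rank ≤ r)
    (P : Matrix (Fin m) (Fin m) K) :
    P * A ∈ tangentSpace (Matrix.stdBasis K (Fin m) (Fin n)) (rankLocus K m n r) A := by
  refine mem_tangentSpace_of_line fun t => ?_
  have e : A + t • (P * A) = (1 + t • P) * A := by simp [Matrix.add_mul]
  rw [e]
  exact (Matrix.rank_mul_le_right _ _).trans h

theorem matrixPairing_eq_trace (C W : Matrix (Fin m) (Fin n) K) :
    matrixPairing K m n C W = (C.transpose * W).trace := by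
  rw [matrixPairing_apply, Matrix.trace, Finset.sum_comm]
  rfl

/-- A nonzero linear form that vanishes on the tangent space at a point of the cone of matrices of
rank at most `r` is given by a matrix of corank at least `r`. -/
theorem rank_le_of_tangentSpace_le_ker [Infinite K] {A C : Matrix (Fin m) (Fin n) K}
    (hA : A.rank ≤ r) (hC : C ≠ 0)
    (h : tangentSpace (Matrix.stdBasis K (Fin m) (Fin n)) (rankLocus K m n r) A ≤
      LinearMap.ker (matrixPairing K m n C)) : C.rank ≤ n - r := by
  rcases hA.lt_or_eq with hlt | heq
  · rw [tangentSpace_rankLocus_eq_top hlt, top_le_iff, LinearMap.ker_eq_top] at h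
    exact absurd ((injective_iff_map_eq_zero _).mp (matrixPairing_injective K m n) C h) hC
  -- Pairing `C` with the tangent vector `single i j 1 * A` gives the entry `(i, j)` of `C * Aᵀ`.
  · have h0 : C * A.transpose = 0 := by
      ext i j
      have := h (mul_mem_tangentSpace hA (Matrix.single i j 1))
      rw [LinearMap.mem_ker, matrixPairing_eq_trace, ← Matrix.mul_assoc, Matrix.trace_mul_comm,
        ← Matrix.mul_assoc, ← Matrix.trace_transpose] at this
      simpa [Matrix.trace_single_mul] using this
    have := Matrix.rank_add_rank_le_card_of_mul_eq_zero h0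
    rw [Matrix.rank_transpose, heq, Fintype.card_fin] at this
    omega

end ProjDual

/-! ### Dual coordinates and closedness of the rank loci. -/

namespace ProjDual

variable {K : Type*} [Field K] {m n r : ℕ}

theorem toDualSpace_mk {A : Matrix (Fin m) (Fin n) K} (h : A ≠ 0) :
    toDualSpace K m n (Projectivization.mk K A h) =
      Projectivization.mk K (matrixPairing K m n A)
        ((map_ne_zero_iff _ (matrixPairing_injective K m n)).mpr h) := rfl

theorem matrixPairing_single (C : Matrix (Fin m) (Fin n) K) (i : Fin m) (j : Fin n) :
    matrixPairing K m n C (Matrix.single i j 1) = C i j := by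
  simp [matrixPairing_apply, Matrix.single_apply, ite_and]

theorem exists_matrixPairing_eq (φ : Module.Dual K (Matrix (Fin m) (Fin n) K)) :
    ∃ C, matrixPairing K m n C = φ := by
  refine ⟨Matrix.of fun i j => φ (Matrix.single i j 1), ?_⟩
  refine (Matrix.stdBasis K (Fin m) (Fin n)).ext fun p => ?_
  rw [Matrix.stdBasis_eq_single, matrixPairing_single]
  rfl

theorem mem_toDualSpace_image_rankLocus {H : ℙ K (Module.Dual K (Matrix (Fin m) (Fin n) K))}
    {C : Matrix (Fin m) (Fin n) K} (hC : matrixPairing K m n C = H.rep) :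
    H ∈ toDualSpace K m n '' rankLocus K m n r ↔ C.rank ≤ r := by
  have h0 : C ≠ 0 := by
    rintro rfl
    exact H.rep_nonzero (by rw [← hC, map_zero])
  have e : toDualSpace K m n (Projectivization.mk K C h0) = H := by
    rw [toDualSpace_mk]
    simp only [hC, Projectivization.mk_rep]
  rw [← mk_mem_rankLocus h0]
  conv_lhs => rw [← e]
  exact (Projectivization.map_injective _ (matrixPairing_injective K m n)).mem_set_image

theorem dualBasis_stdBasis_repr (C : Matrix (Fin m) (Fin n) K) (p : Fin m × Fin n) :
    (Matrix.stdBasis K (Fin m) (Fin n)).dualBasis.repr (matrixPairing K m n C) p = C p.1 p.2 := by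
  obtain ⟨i, j⟩ := p
  rw [Module.Basis.dualBasis_repr, Matrix.stdBasis_eq_single, matrixPairing_single]

/-- The generic matrix, multiplied on both sides by scalar matrices. -/
noncomputable def genericProduct {s t : Type*} (P : Matrix s (Fin m) K) (Q : Matrix (Fin n) t K) :
    Matrix s t (MvPolynomial (Fin m × Fin n) K) :=
  P.map (MvPolynomial.C (σ := Fin m × Fin n)) * Matrix.mvPolynomialX (Fin m) (Fin n) K *
    Q.map (MvPolynomial.C (σ := Fin m × Fin n))

theorem genericProduct_map_eval {s t : Type*} (P : Matrix s (Fin m) K) (Q : Matrix (Fin n) t K)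
    (A : Matrix (Fin m) (Fin n) K) :
    (genericProduct P Q).map (MvPolynomial.eval fun p => A p.1 p.2) = P * A * Q := by
  ext i j
  simp [genericProduct, Matrix.mul_apply]

theorem eval_det_genericProduct {s : Type*} [Fintype s] [DecidableEq s] (P : Matrix s (Fin m) K)
    (Q : Matrix (Fin n) s K) (A : Matrix (Fin m) (Fin n) K) :
    MvPolynomial.eval (fun p => A p.1 p.2) (genericProduct P Q).det = (P * A * Q).det := by
  rw [RingHom.map_det, RingHom.mapMatrix_apply, genericProduct_map_eval]

theorem isHomogeneous_det_genericProduct {s : Type*} [Fintype s] [DecidableEq s]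
    (P : Matrix s (Fin m) K) (Q : Matrix (Fin n) s K) :
    (genericProduct P Q).det.IsHomogeneous (Fintype.card s) := by
  rw [Matrix.det_apply]
  refine MvPolynomial.IsHomogeneous.sum _ _ _ fun σ _ => ?_
  rw [Units.smul_def]
  refine zsmul_mem (K := MvPolynomial.homogeneousSubmodule (Fin m × Fin n) K (Fintype.card s)) ?_ _
  have := MvPolynomial.IsHomogeneous.prod Finset.univ
    (fun i => genericProduct P Q (σ i) i) (fun _ => 1) fun i _ => by
      simp only [genericProduct, Matrix.mul_apply, Matrix.map_apply, Matrix.mvPolynomialX_apply]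
      refine MvPolynomial.IsHomogeneous.sum _ _ _ fun k _ => ?_
      rw [mul_comm]
      refine MvPolynomial.IsHomogeneous.C_mul ?_ _
      refine MvPolynomial.IsHomogeneous.sum _ _ _ fun l _ => ?_
      exact MvPolynomial.IsHomogeneous.C_mul (MvPolynomial.isHomogeneous_X _ _) _
  simpa using this

/-- These determinants generalize minors, which arise when `P` and `Q` select rows and columns. They
supply all the equations of the rank locus used below. -/
theorem det_mul_mul_eq_zero {s : Type*} [Fintype s] [DecidableEq s] (P : Matrix s (Fin m) K)
    (Q : Matrix (Fin n) s K) {A : Matrix (Fin m) (Fin n) K} (h : A.rank < Fintype.card s) :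
    (P * A * Q).det = 0 := by
  by_contra h0
  have h1 := Matrix.rank_of_det_ne_zero h0
  have h2 := Matrix.rank_mul_le_left (P * A) Q
  have h3 := Matrix.rank_mul_le_right P A
  omega

/-- The dual image of a rank locus is Zariski closed. -/
theorem zariskiClosure_subset_image_rankLocus
    {S : Set (ℙ K (Module.Dual K (Matrix (Fin m) (Fin n) K)))}
    (hS : S ⊆ toDualSpace K m n '' rankLocus K m n r) :
    zariskiClosure (Matrix.stdBasis K (Fin m) (Fin n)).dualBasis S ⊆
      toDualSpace K m n '' rankLocus K m n r := by
  intro H hH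
  obtain ⟨C, hC⟩ := exists_matrixPairing_eq H.rep
  rw [mem_toDualSpace_image_rankLocus hC]
  by_contra! hr
  -- With `P * C * Q = 1` of size `r + 1`, the form `det (P * X * Q)` vanishes on the locus but
  -- equals `1` at `C`.
  obtain ⟨P, Q, hPQ⟩ := C.exists_mul_mul_eq_one (Nat.succ_le_of_lt hr)
  have := hH _ _ (isHomogeneous_det_genericProduct P Q) fun q hq => by
    obtain ⟨D, hD⟩ := exists_matrixPairing_eq q.rep
    simp only [← hD, dualBasis_stdBasis_repr]
    rw [eval_det_genericProduct]
    have := (mem_toDualSpace_image_rankLocus hD).mp (hS hq)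
    exact det_mul_mul_eq_zero _ _ (by simpa using Nat.lt_succ_of_le this)
  simp only [← hC, dualBasis_stdBasis_repr] at this
  rw [eval_det_genericProduct, hPQ, Matrix.det_one] at this
  exact one_ne_zero this

theorem tangentHyperplanes_rankLocus_subset [Infinite K] :
    tangentHyperplanes (Matrix.stdBasis K (Fin m) (Fin n)) (rankLocus K m n r) ⊆
      toDualSpace K m n '' rankLocus K m n (n - r) := by
  rintro H ⟨p, hp, -, h⟩
  obtain ⟨C, hC⟩ := exists_matrixPairing_eq H.rep
  rw [mem_toDualSpace_image_rankLocus hC]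
  refine rank_le_of_tangentSpace_le_ker hp ?_ (hC ▸ h)
  rintro rfl
  exact H.rep_nonzero (by rw [← hC, map_zero])

/-! ### The tangent space at a matrix in normal form. -/

/-- The `m × n` matrix whose first `r` diagonal entries are `1` and whose other entries are `0`. -/
def partialOne (K : Type*) [Field K] (m n r : ℕ) : Matrix (Fin m) (Fin n) K :=
  Matrix.of fun i j => if (i : ℕ) = j ∧ (i : ℕ) < r then 1 else 0

theorem rank_le_of_row_eq_zero {A : Matrix (Fin m) (Fin n) K}
    (h : ∀ (i : Fin m) (j : Fin n), r ≤ (i : ℕ) → A i j = 0) : A.rank ≤ r := by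
  refine (A.rank_le_card_of_support_subset {i | (i : ℕ) < r} ?_).trans ?_
  · intro i hi
    by_contra hir
    exact hi (funext fun j => h i j (by simpa using hir))
  · rw [← Finset.card_map Fin.valEmbedding, ← Finset.card_range r]
    refine Finset.card_le_card fun k hk => ?_
    obtain ⟨i, hi, rfl⟩ := Finset.mem_map.mp hk
    simpa using hi

theorem rank_le_of_col_eq_zero {A : Matrix (Fin m) (Fin n) K}
    (h : ∀ (i : Fin m) (j : Fin n), r ≤ (j : ℕ) → A i j = 0) : A.rank ≤ r := by
  rw [← Matrix.rank_transpose]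
  exact rank_le_of_row_eq_zero fun j i hj => h i j hj

theorem rank_mul_partialOne_mul_le (P : Matrix (Fin m) (Fin m) K) (Q : Matrix (Fin n) (Fin n) K) :
    (P * partialOne K m n r * Q).rank ≤ r := by
  refine (Matrix.rank_mul_le_left _ _).trans ((Matrix.rank_mul_le_right _ _).trans ?_)
  refine rank_le_of_row_eq_zero fun i j h => if_neg fun h' => ?_
  omega

/-- Split `W` into its first `r` rows and the rest, which lives in the first `r` columns. Moving
`partialOne` along either piece leaves at most `r` nonzero rows, respectively columns, so the line
stays in the cone. -/
theorem mul_mul_mem_tangentSpace [Infinite K] (P : Matrix (Fin m) (Fin m) K)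
    (Q : Matrix (Fin n) (Fin n) K) {W : Matrix (Fin m) (Fin n) K}
    (hW : ∀ (i : Fin m) (j : Fin n), r ≤ (i : ℕ) → r ≤ (j : ℕ) → W i j = 0) :
    P * W * Q ∈ tangentSpace (Matrix.stdBasis K (Fin m) (Fin n)) (rankLocus K m n r)
      (P * partialOne K m n r * Q) := by
  let W₁ : Matrix (Fin m) (Fin n) K := Matrix.of fun i j => if (i : ℕ) < r then W i j else 0
  let W₂ : Matrix (Fin m) (Fin n) K := Matrix.of fun i j => if (i : ℕ) < r then 0 else W i j
  have e : W = W₁ + W₂ := by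
    ext i j
    by_cases h : (i : ℕ) < r <;> simp [W₁, W₂, h]
  have key (U : Matrix (Fin m) (Fin n) K) (hU : ∀ t : K, (partialOne K m n r + t • U).rank ≤ r) :
      P * U * Q ∈ tangentSpace (Matrix.stdBasis K (Fin m) (Fin n)) (rankLocus K m n r)
        (P * partialOne K m n r * Q) := by
    refine mem_tangentSpace_of_line fun t => ?_
    have : P * partialOne K m n r * Q + t • (P * U * Q) =
        P * (partialOne K m n r + t • U) * Q := by
      simp [Matrix.mul_add, Matrix.add_mul]
    rw [this]
    exact (Matrix.rank_mul_le_left _ _).trans ((Matrix.rank_mul_le_right _ _).trans (hU t))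
  rw [e, Matrix.mul_add, Matrix.add_mul]
  refine add_mem (key _ fun t => rank_le_of_row_eq_zero fun i j h => ?_)
    (key _ fun t => rank_le_of_col_eq_zero fun i j h => ?_)
  · simp [W₁, partialOne, h.not_gt]
  · by_cases hi : (i : ℕ) < r
    · have h' : (i : ℕ) ≠ j := by omega
      simp [W₂, partialOne, h', hi]
    · simp [W₂, partialOne, hi, hW i j (not_lt.mp hi) h]

/-- After undoing `P` and `Q`, take the minor that borders the leading identity block by row `i` and
column `j`. It vanishes on the cone, and its derivative in the direction `W` is `W i j`. -/
theorem eq_zero_of_mem_tangentSpace [Infinite K] {P : Matrix (Fin m) (Fin m) K}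
    {Q : Matrix (Fin n) (Fin n) K} (hP : IsUnit P.det) (hQ : IsUnit Q.det)
    {W : Matrix (Fin m) (Fin n) K}
    (hW : P * W * Q ∈ tangentSpace (Matrix.stdBasis K (Fin m) (Fin n)) (rankLocus K m n r)
      (P * partialOne K m n r * Q)) (i : Fin m) (j : Fin n) (hi : r ≤ i) (hj : r ≤ j) :
    W i j = 0 := by
  have hrm : r ≤ m := hi.trans i.2.le
  have hrn : r ≤ n := hj.trans j.2.le
  let f : Fin r ⊕ Unit → Fin m := Sum.elim (Fin.castLE hrm) fun _ => i
  let g : Fin r ⊕ Unit → Fin n := Sum.elim (Fin.castLE hrn) fun _ => j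
  let P' : Matrix (Fin r ⊕ Unit) (Fin m) K := P⁻¹.submatrix f id
  let Q' : Matrix (Fin n) (Fin r ⊕ Unit) K := Q⁻¹.submatrix id g
  have hPQ (U : Matrix (Fin m) (Fin n) K) : P' * (P * U * Q) * Q' = U.submatrix f g := by
    have h1 : P⁻¹ * (P * U * Q) * Q⁻¹ = U := by
      rw [← Matrix.mul_assoc, ← Matrix.mul_assoc, Matrix.nonsing_inv_mul _ hP, Matrix.one_mul,
        Matrix.mul_assoc, Matrix.mul_nonsing_inv _ hQ, Matrix.mul_one]
    conv_rhs => rw [← h1]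
    rfl
  have hmem : (genericProduct P' Q').det ∈
      coneIdeal (Matrix.stdBasis K (Fin m) (Fin n)) (rankLocus K m n r) := by
    refine mem_coneIdeal_rankLocus.mpr fun A hA => ?_
    rw [eval_det_genericProduct]
    exact det_mul_mul_eq_zero _ _ (by simpa using Nat.lt_succ_of_le hA)
  have h := mem_tangentSpace_rankLocus.mp hW _ hmem
  rw [← MvPolynomial.eval_derivative_line] at h
  have hline : MvPolynomial.aeval (fun p : Fin m × Fin n =>
      Polynomial.C ((P * partialOne K m n r * Q) p.1 p.2) +
        Polynomial.X * Polynomial.C ((P * W * Q) p.1 p.2)) (genericProduct P' Q').det =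
      (Matrix.fromBlocks
        (1 + (Polynomial.X : Polynomial K) •
          (W.submatrix (Fin.castLE hrm) (Fin.castLE hrn)).map Polynomial.C)
        ((Polynomial.X : Polynomial K) •
          (W.submatrix (Fin.castLE hrm) fun _ : Unit => j).map Polynomial.C)
        ((Polynomial.X : Polynomial K) •
          (W.submatrix (fun _ : Unit => i) (Fin.castLE hrn)).map Polynomial.C)
        ((Polynomial.X : Polynomial K) •
          (W.submatrix (fun _ : Unit => i) fun _ : Unit => j).map Polynomial.C)).det := by
    refine Polynomial.funext fun t => ?_
    have h1 := eval_det_genericProduct P' Q' (P * partialOne K m n r * Q + t • (P * W * Q))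
    have h2 : P * partialOne K m n r * Q + t • (P * W * Q) =
        P * (partialOne K m n r + t • W) * Q := by
      simp [Matrix.mul_add, Matrix.add_mul]
    rw [h2, hPQ, ← h2] at h1
    rw [MvPolynomial.eval_aeval_line]
    simp only [Matrix.add_apply, Matrix.smul_apply, smul_eq_mul] at h1
    rw [h1, ← Polynomial.coe_evalRingHom, RingHom.map_det]
    congr 1
    ext (a | a) (b | b)
    · simp [partialOne, Matrix.one_apply, f, g, Fin.ext_iff, apply_ite]; ring
    · have : ¬ (a : ℕ) = j := by omega
      simp [partialOne, f, g, this]; ring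
    · simp [partialOne, f, g, hi.not_gt]; ring
    · simp [partialOne, f, g, hi.not_gt]; ring
  rw [hline, Polynomial.eval_derivative_det_fromBlocks] at h
  exact h

/-- At `P * partialOne * Q`, the tangent space to the cone of matrices of rank at most `r` has the
dimension of the space of matrices supported in the first `r` rows and columns. -/
theorem finrank_tangentSpace_rankLocus [Infinite K] {P : Matrix (Fin m) (Fin m) K}
    {Q : Matrix (Fin n) (Fin n) K} (hP : IsUnit P.det) (hQ : IsUnit Q.det) :
    Module.finrank K (tangentSpace (Matrix.stdBasis K (Fin m) (Fin n)) (rankLocus K m n r)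
      (P * partialOne K m n r * Q)) =
      Fintype.card {p : Fin m × Fin n // (p.1 : ℕ) < r ∨ (p.2 : ℕ) < r} := by
  have hinv (U : Matrix (Fin m) (Fin n) K) : P * (P⁻¹ * U * Q⁻¹) * Q = U := by
    rw [← Matrix.mul_assoc, ← Matrix.mul_assoc, Matrix.mul_nonsing_inv _ hP, Matrix.one_mul,
      Matrix.mul_assoc, Matrix.nonsing_inv_mul _ hQ, Matrix.mul_one]
  have hinv' (U : Matrix (Fin m) (Fin n) K) : P⁻¹ * (P * U * Q) * Q⁻¹ = U := by
    rw [← Matrix.mul_assoc, ← Matrix.mul_assoc, Matrix.nonsing_inv_mul _ hP, Matrix.one_mul,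
      Matrix.mul_assoc, Matrix.mul_nonsing_inv _ hQ, Matrix.mul_one]
  let ψ : tangentSpace (Matrix.stdBasis K (Fin m) (Fin n)) (rankLocus K m n r)
      (P * partialOne K m n r * Q) →ₗ[K]
        ({p : Fin m × Fin n // (p.1 : ℕ) < r ∨ (p.2 : ℕ) < r} → K) :=
    { toFun := fun U p => (P⁻¹ * U.1 * Q⁻¹) p.1.1 p.1.2
      map_add' := fun U V => by ext; simp [Matrix.mul_add, Matrix.add_mul]
      map_smul' := fun c U => by ext; simp }
  have hψ : Function.Bijective ψ := by
    constructor
    · rw [injective_iff_map_eq_zero]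
      rintro ⟨U, hU⟩ h
      have : P⁻¹ * U * Q⁻¹ = 0 := by
        ext i j
        by_cases hij : (i : ℕ) < r ∨ (j : ℕ) < r
        · exact congrFun h ⟨(i, j), hij⟩
        · push Not at hij
          exact eq_zero_of_mem_tangentSpace hP hQ (by rwa [hinv]) i j hij.1 hij.2
      ext1
      simpa [this] using (hinv U).symm
    · intro x
      let W : Matrix (Fin m) (Fin n) K := Matrix.of fun i j =>
        if h : (i : ℕ) < r ∨ (j : ℕ) < r then x ⟨(i, j), h⟩ else 0
      refine ⟨⟨P * W * Q, mul_mul_mem_tangentSpace P Q fun i j hi hj => ?_⟩, ?_⟩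
      · exact dif_neg (by omega)
      · ext ⟨p, hp⟩
        change (P⁻¹ * (P * W * Q) * Q⁻¹) p.1 p.2 = _
        rw [hinv']
        exact dif_pos hp
  rw [(LinearEquiv.ofBijective ψ hψ).finrank_eq, Module.finrank_fintype_fun_eq_card]

/-- Every matrix of corank at least `r` annihilates the tangent space at some matrix of rank `r`. -/
theorem exists_tangentSpace_le_ker [Infinite K] (hnm : n ≤ m) (hrn : r ≤ n)
    {C : Matrix (Fin m) (Fin n) K} (hC : C.rank ≤ n - r) :
    ∃ (P : Matrix (Fin m) (Fin m) K) (Q : Matrix (Fin n) (Fin n) K), IsUnit P.det ∧ IsUnit Q.det ∧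
      ∀ a : K, a ≠ 0 → tangentSpace (Matrix.stdBasis K (Fin m) (Fin n)) (rankLocus K m n r)
        ((a • P) * partialOne K m n r * Q) ≤ LinearMap.ker (matrixPairing K m n C) := by
  have h1 := LinearMap.finrank_range_add_finrank_ker C.mulVecLin
  have h2 := LinearMap.finrank_range_add_finrank_ker C.transpose.mulVecLin
  have h3 := Matrix.rank_transpose C
  rw [Module.finrank_fin_fun] at h1 h2
  simp only [Matrix.rank] at hC h3
  -- The kernel of `Cᵀ` has dimension at least `m - (n - r)`, which is at least `r` because `n ≤ m`.
  -- With these choices `Pᵀ * C * Q` is zero in its first `r` rows and columns, complementary to the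
  -- support of `W`.
  obtain ⟨P₀, hP₀, hPC₀⟩ := exists_isUnit_det_col_mem (r := r)
    (LinearMap.ker C.transpose.mulVecLin) (by omega)
  obtain ⟨Q, hQ, hQC⟩ := exists_isUnit_det_col_mem (r := r) (LinearMap.ker C.mulVecLin) (by omega)
  refine ⟨P₀, Q.transpose, hP₀, by rwa [Matrix.det_transpose], fun a ha U hU => ?_⟩
  -- The scalar `a` is kept free because the representative of a projective point is fixed only up
  -- to a unit.
  set P := a • P₀ with hPa
  have hP : IsUnit P.det := by
    rw [hPa, Matrix.det_smul]
    exact (ha.isUnit.pow _).mul hP₀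
  have hPC (i : Fin m) (hi : (i : ℕ) < r) : P.col i ∈ LinearMap.ker C.transpose.mulVecLin :=
    Submodule.smul_mem _ a (hPC₀ i hi)
  have hQ' : IsUnit Q.transpose.det := by rwa [Matrix.det_transpose]
  obtain ⟨W, rfl⟩ : ∃ W, U = P * W * Q.transpose := ⟨P⁻¹ * U * Q.transpose⁻¹, by
    rw [← Matrix.mul_assoc, ← Matrix.mul_assoc, Matrix.mul_nonsing_inv _ hP, Matrix.one_mul,
      Matrix.mul_assoc, Matrix.nonsing_inv_mul _ hQ', Matrix.mul_one]⟩
  have hW := eq_zero_of_mem_tangentSpace hP hQ' hU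
  have e : matrixPairing K m n C (P * W * Q.transpose) =
      matrixPairing K m n (P.transpose * C * Q) W := by
    rw [matrixPairing_eq_trace, matrixPairing_eq_trace, Matrix.transpose_mul, Matrix.transpose_mul,
      Matrix.transpose_transpose, ← Matrix.mul_assoc, Matrix.trace_mul_comm]
    simp only [Matrix.mul_assoc]
  rw [LinearMap.mem_ker, e, matrixPairing_apply]
  refine Finset.sum_eq_zero fun i _ => Finset.sum_eq_zero fun j _ => ?_
  by_cases hj : (j : ℕ) < r
  · have : (C * Q).col j = 0 := hQC j hj
    have : (P.transpose * C * Q) i j = 0 := by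
      rw [Matrix.mul_assoc, Matrix.mul_apply]
      exact Finset.sum_eq_zero fun k _ => by
        rw [show (C * Q) k j = 0 from congrFun this k, mul_zero]
    rw [this, zero_mul]
  by_cases hi : (i : ℕ) < r
  · have : (C.transpose * P).col i = 0 := hPC i hi
    have : (P.transpose * C * Q) i j = 0 := by
      rw [Matrix.mul_apply]
      refine Finset.sum_eq_zero fun k _ => ?_
      have h4 : P.transpose * C = (C.transpose * P).transpose := by simp
      rw [h4, Matrix.transpose_apply, show (C.transpose * P) k i = 0 from congrFun this k, zero_mul]
    rw [this, zero_mul]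
  · rw [hW i j (not_lt.mp hi) (not_lt.mp hj), mul_zero]

end ProjDual

/-! ### Irreducibility and dimension of the cone. -/

namespace ProjDual

variable {K : Type*} [Field K] {m n r : ℕ}

/-- The matrices of rank at most `r` are the products of two matrices with a fixed idempotent of
rank `r` in between. -/
theorem rank_le_iff_exists_mul_diagonal_mul {A : Matrix (Fin m) (Fin n) K} :
    A.rank ≤ r ↔ ∃ (P : Matrix (Fin m) (Fin n) K) (Q : Matrix (Fin n) (Fin n) K),
      A = P * Matrix.diagonal (fun k : Fin n => if (k : ℕ) < n - r then (0 : K) else 1) * Q := by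
  classical
  constructor
  · intro h
    have h1 := LinearMap.finrank_range_add_finrank_ker A.mulVecLin
    rw [Module.finrank_fin_fun] at h1
    rw [Matrix.rank] at h
    -- The first `n - r` columns of `Q` lie in the kernel of `A`, so the idempotent, which kills
    -- those columns, fixes `A * Q`.
    obtain ⟨Q, hQ, hQA⟩ := exists_isUnit_det_col_mem (r := n - r) (LinearMap.ker A.mulVecLin)
      (by omega)
    refine ⟨A * Q, Q⁻¹, ?_⟩
    have e : A * Q * Matrix.diagonal (fun k : Fin n => if (k : ℕ) < n - r then (0 : K) else 1) =
        A * Q := by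
      ext i k
      rw [Matrix.mul_diagonal]
      split_ifs with hk
      · have : (A * Q).col k = 0 := hQA k hk
        rw [mul_zero]
        exact (congrFun this i).symm
      · rw [mul_one]
    rw [e, Matrix.mul_assoc, Matrix.mul_nonsing_inv _ hQ, Matrix.mul_one]
  · rintro ⟨P, Q, rfl⟩
    refine (Matrix.rank_mul_le_left _ _).trans ((Matrix.rank_mul_le_right _ _).trans ?_)
    rw [Matrix.rank_diagonal]
    have hk (k : {k : Fin n // (if (k : ℕ) < n - r then (0 : K) else 1) ≠ 0}) :
        n - r ≤ (k : Fin n) := by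
      have := k.2
      by_contra! h
      exact this (if_pos h)
    refine (Fintype.card_le_of_injective (β := Fin r)
      (fun k => ⟨n - 1 - (k.1 : ℕ), by have := hk k; have := k.1.2; omega⟩) fun k l h => ?_).trans
        (Fintype.card_fin r).le
    have h' := congrArg Fin.val h
    have := k.1.2
    have := l.1.2
    ext
    simp only at h'
    omega

/-- The cone is the image of an affine space under `(P, Q) ↦ P * diagonal F * Q`, so its ideal is
the kernel of the pullback `φ` into a polynomial ring, a domain. -/
theorem isPrime_coneIdeal_rankLocus [Infinite K] :
    (coneIdeal (Matrix.stdBasis K (Fin m) (Fin n)) (rankLocus K m n r)).IsPrime := by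
  let F : Fin n → K := fun k => if (k : ℕ) < n - r then 0 else 1
  let φ : MvPolynomial (Fin m × Fin n) K →ₐ[K]
      MvPolynomial ((Fin m × Fin n) ⊕ (Fin n × Fin n)) K :=
    MvPolynomial.aeval fun p => ∑ k, MvPolynomial.X (Sum.inl (p.1, k)) * MvPolynomial.C (F k) *
      MvPolynomial.X (Sum.inr (k, p.2))
  have hφ (P : Matrix (Fin m) (Fin n) K) (Q : Matrix (Fin n) (Fin n) K)
      (f : MvPolynomial (Fin m × Fin n) K) :
      MvPolynomial.eval (Sum.elim (fun p => P p.1 p.2) fun p => Q p.1 p.2) (φ f) =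
        MvPolynomial.eval (fun p => (P * Matrix.diagonal F * Q) p.1 p.2) f := by
    rw [← MvPolynomial.aeval_eq_eval, ← MvPolynomial.aeval_eq_eval, ← AlgHom.comp_apply]
    refine congrArg (fun ψ : MvPolynomial (Fin m × Fin n) K →ₐ[K] K => ψ f) ?_
    ext p
    simp [φ, Matrix.mul_apply, Matrix.diagonal_apply]
  have hker : coneIdeal (Matrix.stdBasis K (Fin m) (Fin n)) (rankLocus K m n r) =
      RingHom.ker φ := by
    ext f
    rw [mem_coneIdeal_rankLocus, RingHom.mem_ker]
    constructor
    · intro h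
      refine MvPolynomial.funext fun x => ?_
      have e : x = Sum.elim
          (fun p => (Matrix.of fun i k => x (Sum.inl (i, k)) : Matrix (Fin m) (Fin n) K) p.1 p.2)
          fun p => (Matrix.of fun i k => x (Sum.inr (i, k)) : Matrix (Fin n) (Fin n) K) p.1 p.2 := by
        ext (p | p) <;> rfl
      rw [e, hφ, map_zero]
      exact h _ (rank_le_iff_exists_mul_diagonal_mul.mpr ⟨_, _, rfl⟩)
    · intro h A hA
      obtain ⟨P, Q, rfl⟩ := rank_le_iff_exists_mul_diagonal_mul.mp hA
      rw [← hφ, h, map_zero]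
  rw [hker]
  exact RingHom.ker_isPrime _

section Coordinates

variable {T : Type*} [CommRing T]

/-- The first `r` columns of a matrix whose entries are known in the first `r` rows and columns. -/
def leftColumns (hn : r ≤ n) (x : {p : Fin m × Fin n // (p.1 : ℕ) < r ∨ (p.2 : ℕ) < r} → T) :
    Matrix (Fin m) (Fin r) T :=
  Matrix.of fun i k => x ⟨(i, Fin.castLE hn k), Or.inr k.2⟩

/-- The first `r` rows of a matrix whose entries are known in the first `r` rows and columns. -/
def topRows (hm : r ≤ m) (x : {p : Fin m × Fin n // (p.1 : ℕ) < r ∨ (p.2 : ℕ) < r} → T) :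
    Matrix (Fin r) (Fin n) T :=
  Matrix.of fun k j => x ⟨(Fin.castLE hm k, j), Or.inl k.2⟩

/-- The leading `r × r` block of a matrix whose entries are known in the first `r` rows and
columns. -/
def corner (hm : r ≤ m) (hn : r ≤ n)
    (x : {p : Fin m × Fin n // (p.1 : ℕ) < r ∨ (p.2 : ℕ) < r} → T) : Matrix (Fin r) (Fin r) T :=
  (leftColumns hn x).submatrix (Fin.castLE hm) id

/-- The determinant of the leading block times the completion to a matrix of rank at most `r`. -/
def scaledCompletion (hm : r ≤ m) (hn : r ≤ n)
    (x : {p : Fin m × Fin n // (p.1 : ℕ) < r ∨ (p.2 : ℕ) < r} → T) : Matrix (Fin m) (Fin n) T :=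
  leftColumns hn x * (corner hm hn x).adjugate * topRows hm x

variable {U : Type*} [CommRing U] (φ : T →+* U) (hm : r ≤ m) (hn : r ≤ n)
  (x : {p : Fin m × Fin n // (p.1 : ℕ) < r ∨ (p.2 : ℕ) < r} → T)

theorem map_det_corner :
    φ (corner hm hn x).det = (corner hm hn fun p => φ (x p)).det := by
  rw [RingHom.map_det]
  rfl

theorem map_scaledCompletion (i : Fin m) (j : Fin n) :
    φ (scaledCompletion hm hn x i j) = scaledCompletion hm hn (fun p => φ (x p)) i j := by
  have h : (scaledCompletion hm hn x).map φ = scaledCompletion hm hn (fun p => φ (x p)) := by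
    rw [scaledCompletion, Matrix.map_mul, Matrix.map_mul,
      ← RingHom.mapMatrix_apply φ (corner _ _ _).adjugate, RingHom.map_adjugate]
    rfl
  exact congrFun (congrFun h i) j

end Coordinates

/-- The minor bordering the corner by row `i` and column `j` vanishes; its Schur complement
expresses `A i j` through the first `r` rows and columns. -/
theorem scaledCompletion_eq_of_rank_le (hm : r ≤ m) (hn : r ≤ n) {A : Matrix (Fin m) (Fin n) K}
    (hA : A.rank ≤ r) (hdet : (corner hm hn fun p => A p.1.1 p.1.2).det ≠ 0)
    (i : Fin m) (j : Fin n) :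
    scaledCompletion hm hn (fun p => A p.1.1 p.1.2) i j =
      (corner hm hn fun p => A p.1.1 p.1.2).det * A i j := by
  set x : {p : Fin m × Fin n // (p.1 : ℕ) < r ∨ (p.2 : ℕ) < r} → K := fun p => A p.1.1 p.1.2
  let f : Fin r ⊕ Unit → Fin m := Sum.elim (Fin.castLE hm) fun _ => i
  let g : Fin r ⊕ Unit → Fin n := Sum.elim (Fin.castLE hn) fun _ => j
  have h0 : (A.submatrix f g).det = 0 := by
    have := det_mul_mul_eq_zero ((1 : Matrix (Fin m) (Fin m) K).submatrix f id)
      ((1 : Matrix (Fin n) (Fin n) K).submatrix id g) (A := A) (by simpa using Nat.lt_succ_of_le hA)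
    have e : (1 : Matrix (Fin m) (Fin m) K).submatrix f id * A *
        (1 : Matrix (Fin n) (Fin n) K).submatrix id g =
        ((1 : Matrix (Fin m) (Fin m) K) * A * (1 : Matrix (Fin n) (Fin n) K)).submatrix f g :=
      rfl
    rwa [e, Matrix.one_mul, Matrix.mul_one] at this
  have h1 : A.submatrix f g = Matrix.fromBlocks (corner hm hn x)
      ((topRows hm x).submatrix id fun _ => j) ((leftColumns hn x).submatrix (fun _ => i) id)
      (Matrix.of fun _ _ : Unit => A i j) := by
    ext (a | a) (b | b) <;> rfl
  have : Invertible (corner hm hn x) := Matrix.invertibleOfIsUnitDet _ hdet.isUnit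
  rw [h1, Matrix.det_fromBlocks₁₁, mul_eq_zero, or_iff_right hdet, Matrix.det_unique,
    Matrix.invOf_eq_nonsing_inv, Matrix.inv_def, Ring.inverse_eq_inv'] at h0
  have h2 : A i j = (corner hm hn x).det⁻¹ * scaledCompletion hm hn x i j := by
    rw [Matrix.sub_apply, sub_eq_zero] at h0
    refine h0.trans ?_
    rw [Matrix.mul_smul, Matrix.smul_mul]
    rfl
  rw [h2, mul_inv_cancel_left₀ hdet]

/-- The completion factors through dimension `r`. It shows that the chosen coordinates take
arbitrary values on the cone away from a hypersurface, whence their algebraic independence. -/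
theorem exists_rank_le_of_det_corner_ne_zero (hm : r ≤ m) (hn : r ≤ n)
    {x : {p : Fin m × Fin n // (p.1 : ℕ) < r ∨ (p.2 : ℕ) < r} → K}
    (hdet : (corner hm hn x).det ≠ 0) :
    ∃ A : Matrix (Fin m) (Fin n) K, A.rank ≤ r ∧ (fun p => A p.1.1 p.1.2) = x := by
  refine ⟨leftColumns hn x * (corner hm hn x)⁻¹ * topRows hm x, ?_, ?_⟩
  · exact (Matrix.rank_mul_le_right _ _).trans (Matrix.rank_le_height _)
  · ext ⟨⟨i, j⟩, h⟩
    by_cases hi : (i : ℕ) < r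
    · have h1 : ((leftColumns hn x * (corner hm hn x)⁻¹ * topRows hm x).submatrix
          (Fin.castLE hm) id) = topRows hm x := by
        change corner hm hn x * (corner hm hn x)⁻¹ * topRows hm x = _
        rw [Matrix.mul_nonsing_inv _ hdet.isUnit, Matrix.one_mul]
      exact congrFun (congrFun h1 ⟨i, hi⟩) j
    · have hj := h.resolve_left hi
      have h1 : ((leftColumns hn x * (corner hm hn x)⁻¹ * topRows hm x).submatrix
          id (Fin.castLE hn)) = leftColumns hn x := by
        change leftColumns hn x * (corner hm hn x)⁻¹ * corner hm hn x = _
        rw [Matrix.mul_assoc, Matrix.nonsing_inv_mul _ hdet.isUnit, Matrix.mul_one]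
      exact congrFun (congrFun h1 i) ⟨j, hj⟩

theorem det_corner_X_ne_zero (hm : r ≤ m) (hn : r ≤ n) :
    (corner hm hn (MvPolynomial.X (R := K))).det ≠ 0 := by
  intro h
  have := congrArg (MvPolynomial.eval fun p => if (p.1.1 : ℕ) = p.1.2 then (1 : K) else 0) h
  rw [map_det_corner] at this
  have e : (corner hm hn fun p => MvPolynomial.eval (fun p => if (p.1.1 : ℕ) = p.1.2 then (1 : K)
      else 0) (MvPolynomial.X p)) = 1 := by
    ext i j
    simp [corner, leftColumns, Matrix.one_apply, Fin.ext_iff]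
  rw [e] at this
  simp at this

/-- The coordinate functions in the first `r` rows and columns are a transcendence basis of the
coordinate ring of the cone of matrices of rank at most `r`. -/
theorem isTranscendenceBasis_rankLocus [Infinite K] (hm : r ≤ m) (hn : r ≤ n) :
    IsTranscendenceBasis K
      fun p : {p : Fin m × Fin n // (p.1 : ℕ) < r ∨ (p.2 : ℕ) < r} =>
        Ideal.Quotient.mk (coneIdeal (Matrix.stdBasis K (Fin m) (Fin n)) (rankLocus K m n r))
          (MvPolynomial.X p.1) := by
  have := isPrime_coneIdeal_rankLocus (K := K) (m := m) (n := n) (r := r)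
  set I := coneIdeal (Matrix.stdBasis K (Fin m) (Fin n)) (rankLocus K m n r) with hI
  set ξ : {p : Fin m × Fin n // (p.1 : ℕ) < r ∨ (p.2 : ℕ) < r} → MvPolynomial (Fin m × Fin n) K ⧸ I
    := fun p => Ideal.Quotient.mk I (MvPolynomial.X p.1) with hξ
  have hmk (f : MvPolynomial {p : Fin m × Fin n // (p.1 : ℕ) < r ∨ (p.2 : ℕ) < r} K) :
      MvPolynomial.aeval ξ f = Ideal.Quotient.mk I (MvPolynomial.rename Subtype.val f) := by
    change _ = ((Ideal.Quotient.mkₐ K I).comp (MvPolynomial.rename Subtype.val)) f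
    refine congrArg (fun ψ : MvPolynomial _ K →ₐ[K] _ => ψ f) ?_
    ext p
    simp [hξ]
  have hzero (f : MvPolynomial {p : Fin m × Fin n // (p.1 : ℕ) < r ∨ (p.2 : ℕ) < r} K)
      (hf : MvPolynomial.aeval ξ f = 0) : f = 0 := by
    rw [hmk, Ideal.Quotient.eq_zero_iff_mem, hI, mem_coneIdeal_rankLocus] at hf
    refine (mul_eq_zero.mp ?_).resolve_right (det_corner_X_ne_zero hm hn)
    refine MvPolynomial.funext fun x => ?_
    rw [map_mul, map_zero, map_det_corner, mul_eq_zero, or_iff_not_imp_right]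
    simp only [MvPolynomial.eval_X]
    intro hx
    obtain ⟨A, hA, hAx⟩ := exists_rank_le_of_det_corner_ne_zero hm hn hx
    have := hf A hA
    rw [MvPolynomial.eval_rename] at this
    exact (congrArg (fun y => MvPolynomial.eval y f) hAx.symm).trans this
  have hind : AlgebraicIndependent K ξ := algebraicIndependent_iff.mpr hzero
  rw [hind.isTranscendenceBasis_iff_isAlgebraic]
  have hB (f : MvPolynomial {p : Fin m × Fin n // (p.1 : ℕ) < r ∨ (p.2 : ℕ) < r} K) :
      MvPolynomial.aeval ξ f ∈ Algebra.adjoin K (Set.range ξ) := by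
    rw [Algebra.adjoin_range_eq_range_aeval]
    exact ⟨f, rfl⟩
  have hX (i : Fin m) (j : Fin n) : IsAlgebraic (Algebra.adjoin K (Set.range ξ))
      (Ideal.Quotient.mk I (MvPolynomial.X (i, j))) := by
    have hne : MvPolynomial.aeval ξ (corner hm hn (MvPolynomial.X (R := K))).det ≠ 0 := fun h =>
      det_corner_X_ne_zero hm hn (hzero _ h)
    have hrel : MvPolynomial.aeval ξ (corner hm hn (MvPolynomial.X (R := K))).det *
        Ideal.Quotient.mk I (MvPolynomial.X (i, j)) =
        MvPolynomial.aeval ξ (scaledCompletion hm hn (MvPolynomial.X (R := K)) i j) := by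
      -- The extra factor `det` makes both sides vanish where the corner is singular, so the
      -- relation need only be checked where it is invertible.
      refine mul_left_cancel₀ hne ?_
      rw [hmk, hmk, ← map_mul, ← map_mul, ← map_mul, Ideal.Quotient.mk_eq_mk_iff_sub_mem, hI,
        mem_coneIdeal_rankLocus]
      intro A hA
      simp only [map_sub, map_mul, MvPolynomial.eval_rename, MvPolynomial.eval_X, map_det_corner,
        map_scaledCompletion, Function.comp_apply]
      by_cases h : (corner hm hn fun p => A p.1.1 p.1.2).det = 0
      · rw [h, zero_mul, zero_mul, sub_zero]
      · rw [scaledCompletion_eq_of_rank_le hm hn hA h, sub_self]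
    -- `X (i, j)` is a root of a linear polynomial whose leading coefficient is the nonzero corner
    -- determinant.
    refine ⟨Polynomial.C ⟨_, hB (corner hm hn MvPolynomial.X).det⟩ * Polynomial.X -
      Polynomial.C ⟨_, hB (scaledCompletion hm hn MvPolynomial.X i j)⟩, fun h => hne ?_, ?_⟩
    · have := congrArg (fun p => ((p.coeff 1 : Algebra.adjoin K (Set.range ξ)) :
        MvPolynomial (Fin m × Fin n) K ⧸ I)) h
      simpa [Polynomial.coeff_C] using this
    · simp only [map_sub, map_mul, Polynomial.aeval_C, Polynomial.aeval_X]
      exact sub_eq_zero.mpr hrel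
  refine ⟨fun y => ?_⟩
  obtain ⟨f, rfl⟩ := Ideal.Quotient.mk_surjective y
  induction f using MvPolynomial.induction_on with
  | C c => exact isAlgebraic_algebraMap (algebraMap K (Algebra.adjoin K (Set.range ξ)) c)
  | add p q hp hq => rw [map_add]; exact hp.add hq
  | mul_X p i hp => rw [map_mul]; exact hp.mul (hX i.1 i.2)

theorem ringKrullDim_rankLocus [Infinite K] (hm : r ≤ m) (hn : r ≤ n) :
    ringKrullDim (MvPolynomial (Fin m × Fin n) K ⧸
      coneIdeal (Matrix.stdBasis K (Fin m) (Fin n)) (rankLocus K m n r)) =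
      Fintype.card {p : Fin m × Fin n // (p.1 : ℕ) < r ∨ (p.2 : ℕ) < r} := by
  have := isPrime_coneIdeal_rankLocus (K := K) (m := m) (n := n) (r := r)
  exact ringKrullDim_eq_card_of_isTranscendenceBasis (isTranscendenceBasis_rankLocus hm hn)

/-! ### Tangent hyperplanes and the dual variety. -/

/-- The tangent hyperplanes of the locus of matrices of rank at most `r` are the matrices of corank
at least `r`. -/
theorem tangentHyperplanes_rankLocus [Infinite K] (hnm : n ≤ m) (hr : 0 < r) (hrn : r ≤ n) :
    tangentHyperplanes (Matrix.stdBasis K (Fin m) (Fin n)) (rankLocus K m n r) =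
      toDualSpace K m n '' rankLocus K m n (n - r) := by
  refine tangentHyperplanes_rankLocus_subset.antisymm fun H hH => ?_
  obtain ⟨C, hC⟩ := exists_matrixPairing_eq H.rep
  rw [mem_toDualSpace_image_rankLocus hC] at hH
  obtain ⟨P, Q, hP, hQ, hPQ⟩ := exists_tangentSpace_le_ker hnm hrn hH
  -- At the zero matrix, of rank `0 < r`, the tangent space is everything, which would force the
  -- form of `H` to vanish.
  have h0 : P * partialOne K m n r * Q ≠ 0 := by
    intro h0
    have := hPQ 1 one_ne_zero
    rw [one_smul, h0, tangentSpace_rankLocus_eq_top (by simpa using hr), top_le_iff,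
      LinearMap.ker_eq_top, hC] at this
    exact H.rep_nonzero this
  obtain ⟨a, ha⟩ := Projectivization.exists_smul_eq_mk_rep K _ h0
  have hrep : (a : K) • P * partialOne K m n r * Q =
      (Projectivization.mk K (P * partialOne K m n r * Q) h0).rep := by
    rw [← ha, Units.smul_def, Matrix.smul_mul, Matrix.smul_mul]
  refine ⟨Projectivization.mk K _ h0, (mk_mem_rankLocus h0).mpr (rank_mul_partialOne_mul_le P Q),
    ?_, ?_⟩
  · have hP' : IsUnit ((a : K) • P).det := by
      rw [Matrix.det_smul]
      exact (a.isUnit.pow _).mul hP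
    rw [IsNonsingularAt, ← hrep, finrank_tangentSpace_rankLocus hP' hQ,
      ringKrullDim_rankLocus (hrn.trans hnm) hrn]
  · rw [← hrep, ← hC]
    exact hPQ a a.ne_zero

theorem dualVariety_rankLocus [Infinite K] (hnm : n ≤ m) (hr : 0 < r) (hrn : r ≤ n) :
    dualVariety (Matrix.stdBasis K (Fin m) (Fin n)) (rankLocus K m n r) =
      toDualSpace K m n '' rankLocus K m n (n - r) := by
  rw [dualVariety, tangentHyperplanes_rankLocus hnm hr hrn]
  exact (zariskiClosure_subset_image_rankLocus subset_rfl).antisymm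
    fun p hp f d _ h => h p hp

theorem detHypersurface_eq_rankLocus (k : ℕ) : detHypersurface K (k + 1) =
    rankLocus K (k + 1) (k + 1) k := by
  ext p
  change p.rep.det = 0 ↔ p.rep.rank ≤ k
  constructor
  · intro h
    by_contra! hk
    obtain ⟨P, Q, hPQ⟩ := p.rep.exists_mul_mul_eq_one (Nat.succ_le_of_lt hk)
    have := congrArg Matrix.det hPQ
    rw [Matrix.det_mul, Matrix.det_mul, h, mul_zero, zero_mul, Matrix.det_one] at this
    exact zero_ne_one this
  · intro h
    by_contra h0
    have := Matrix.rank_of_det_ne_zero h0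
    rw [Fintype.card_fin] at this
    omega

end ProjDual

theorem theorem3p5 :
    (∀ k₀ k₁ r : ℕ, k₁ ≤ k₀ → 1 ≤ r → r ≤ k₁ + 1 →
      ProjDual.dualVariety (Matrix.stdBasis ℂ (Fin (k₀ + 1)) (Fin (k₁ + 1)))
          (ProjDual.rankLocus ℂ (k₀ + 1) (k₁ + 1) r) =
        ProjDual.toDualSpace ℂ (k₀ + 1) (k₁ + 1) ''
          ProjDual.rankLocus ℂ (k₀ + 1) (k₁ + 1) (k₁ + 1 - r)) ∧
    (∀ k : ℕ,
      ProjDual.dualVariety (Matrix.stdBasis ℂ (Fin (k + 1)) (Fin (k + 1)))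
          (ProjDual.rankLocus ℂ (k + 1) (k + 1) 1) =
        ProjDual.toDualSpace ℂ (k + 1) (k + 1) '' ProjDual.detHypersurface ℂ (k + 1)) := by
  refine ⟨fun k₀ k₁ r h hr hr' => ProjDual.dualVariety_rankLocus (by omega) hr hr', fun k => ?_⟩
  rw [ProjDual.dualVariety_rankLocus le_rfl one_pos (by omega),
    ProjDual.detHypersurface_eq_rankLocus, Nat.add_sub_cancel]
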